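/- Let $r\ge 2$ and let $\mathcal R_r$ be the $r$-rose, the graph with one vertex and $r$ edges (petals). For a length function $\ell=(\ell^1,\dots,\ell^r)\in\mathbb R_{>0}^r$ let $$\mathfrak h(\ell)=\lim_{t\to\infty}\tfrac1t\log\#\{\text{based circuits }\gamma\text{ in }\mathcal R_r:\ \ell(\gamma)\le t\}$$ be its entropy, where a based circuit is a nonempty sequence $(e_1,\dots,e_n)$ of directed edges in which no edge is followed cyclically by its reverse (i.e. $e_i\ne\bar e_{i+1}$ for $i<n$, and $e_n\ne\bar e_1$), and $\ell(\gamma)$ is the sum of the lengths of its edges. Let $\mathcal M^1(\mathcal R_r)=\{\ell\in\mathbb R_{>0}^r:\mathfrak h(\ell)=1\}$, equipped with the entropy metric $\|v\|_{\mathfrak h}^2=\langle v,\mathbf H[\mathfrak h(\ell)]v\rangle$, where $\mathbf H$ denotes the Hessian and $v$ is tangent to $\mathcal M^1(\mathcal R_r)$ at $\ell$, and let $d_{\mathfrak h,\mathcal R_r}$ be the induced distance, i.e. $d_{\mathfrak h,\mathcal R_r}(x,y)$ is the infimum of the lengths $\int_0^1\|\dot\ell_t\|_{\mathfrak h}\,dt$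 over piecewise smooth paths $\ell_t$, $t\in[0,1]$, in $\mathcal M^1(\mathcal R_r)$ with $\ell_0=x$ and $\ell_1=y$. Write $\mathbf 1=(1,\dots,1)$. Then $\log(2r-1)\cdot\mathbf 1\in\mathcal M^1(\mathcal R_r)$, and for every $D>0$ there is an $\epsilon>0$ such that for every $\ell\in\mathcal M^1(\mathcal R_r)$ with $\min_{1\le i\le r}\ell^i\le\epsilon$ we have $$d_{\mathfrak h,\mathcal R_r}\bigl(\log(2r-1)\cdot\mathbf 1,\ \ell\bigr)\ge D.$$ In particular, $(\mathcal M^1(\mathcal R_r),d_{\mathfrak h,\mathcal R_r})$ has infinite diameter: the (finite) distances between its points are unbounded. -/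

import Mathlib

open Filter Topology Set

open scoped ContDiff

namespace EntropyMetric

/-- A graph with vertex set `V` together with an orientation: `E` is the set `E₊` of positively
oriented edges, `src` and `tgt` give their endpoints. Loops and multiple edges are allowed. -/
structure OrientedGraph (V E : Type*) where
  src : E → V
  tgt : E → V

/-- The directed edges: `(e, true)` is the positive edge `e`, `(e, false)` its reverse. -/
abbrev DirEdge (E : Type*) : Type _ := E × Bool

/-- The fixed point free involution reversing directed edges. -/
def rev {E : Type*} (e : DirEdge E) : DirEdge E := (e.1, !e.2)

namespace OrientedGraph

variable {V E : Type*}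

/-- Originating vertex of a directed edge. -/
def orig (G : OrientedGraph V E) (e : DirEdge E) : V := if e.2 then G.src e.1 else G.tgt e.1

/-- Terminating vertex of a directed edge. -/
def term (G : OrientedGraph V E) (e : DirEdge E) : V := if e.2 then G.tgt e.1 else G.src e.1

/-- Edge paths `(e₁, …, eₙ)`: the end of each edge is the origin of the next one. -/
def IsEdgePath (G : OrientedGraph V E) (p : List (DirEdge E)) : Prop :=
  p.IsChain fun e e' => G.term e = G.orig e'

/-- Reduced (no backtracking) edge paths. -/
def IsReducedPath (G : OrientedGraph V E) (p : List (DirEdge E)) : Prop :=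
  G.IsEdgePath p ∧ p.IsChain fun e e' => e ≠ rev e'

/-- Based circuits: nonempty reduced edge paths that close up and are cyclically reduced. -/
def IsBasedCircuit (G : OrientedGraph V E) (p : List (DirEdge E)) : Prop :=
  G.IsReducedPath p ∧
    ∃ h : p ≠ [], G.term (p.getLast h) = G.orig (p.head h) ∧ p.getLast h ≠ rev (p.head h)

/-- The length of an edge path for `ℓ : E₊ → ℝ`; an edge and its reverse have the same length. -/
def pathLen (ℓ : E → ℝ) (p : List (DirEdge E)) : ℝ := (p.map fun e => ℓ e.1).sum

/-- The based circuits of `ℓ`-length at most `t`. -/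
def circuits (G : OrientedGraph V E) (ℓ : E → ℝ) (t : ℝ) : Set (List (DirEdge E)) :=
  {p | G.IsBasedCircuit p ∧ pathLen ℓ p ≤ t}

/-- The entropy of a length function: the exponential growth rate of the number of based circuits
of length at most `t`, as `t → ∞`. -/
noncomputable def entropy (G : OrientedGraph V E) (ℓ : E → ℝ) : ℝ :=
  limUnder atTop fun t : ℝ => (1 / t) * Real.log ((G.circuits ℓ t).ncard : ℝ)

/-- The length functions of unit entropy. -/
def unitEntropy (G : OrientedGraph V E) : Set (E → ℝ) :=
  {ℓ | (∀ e, 0 < ℓ e) ∧ G.entropy ℓ = 1}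

/-- The norm of the entropy metric: the square root of the Hessian quadratic form
`v ↦ ∑ i j, v i * v j * ∂ᵢ ∂ⱼ h (ℓ)` of the entropy function `h` at `ℓ`. -/
noncomputable def entropyNorm [Fintype E] (G : OrientedGraph V E) (ℓ v : E → ℝ) : ℝ :=
  Real.sqrt (fderiv ℝ (fderiv ℝ G.entropy) ℓ v v)

/-- The entropy length of a path parametrized by `[0, 1]`. -/
noncomputable def entropyLength [Fintype E] (G : OrientedGraph V E) (γ : ℝ → E → ℝ) : ℝ :=
  ∫ t in (0 : ℝ)..1, G.entropyNorm (γ t) (deriv γ t)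

end OrientedGraph

/-- Piecewise smooth paths on `[0, 1]`: continuous, and smooth up to the endpoints on each
of the finitely many closed intervals of a suitable partition of `[0, 1]`. -/
def IsPiecewiseSmooth {F : Type*} [NormedAddCommGroup F] [NormedSpace ℝ F] (γ : ℝ → F) : Prop :=
  ContinuousOn γ (Icc 0 1) ∧
    ∃ (n : ℕ) (t : Fin (n + 1) → ℝ), StrictMono t ∧ t 0 = 0 ∧ t (Fin.last n) = 1 ∧
      ∀ k : Fin n, ContDiffOn ℝ ∞ γ (Icc (t k.castSucc) (t k.succ))

namespace OrientedGraph

variable {V E : Type*}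

/-- The entropy distance between two length functions of unit entropy: the infimum of the entropy
lengths of the piecewise smooth paths joining them within the unit entropy length functions.
It is real valued, and `0` by convention if there is no such path, so that a positive lower bound
on it entails that there is one. -/
noncomputable def entropyDist [Fintype E] (G : OrientedGraph V E) (x y : E → ℝ) : ℝ :=
  sInf {L | ∃ γ : ℝ → E → ℝ, IsPiecewiseSmooth γ ∧ (∀ t ∈ Icc (0 : ℝ) 1, γ t ∈ G.unitEntropy) ∧
    γ 0 = x ∧ γ 1 = y ∧ L = G.entropyLength γ}

end OrientedGraph

/-- The `r`-rose: one vertex and `r` edges (petals). -/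
def rose (r : ℕ) : OrientedGraph Unit (Fin r) where
  src _ := ()
  tgt _ := ()

end EntropyMetric

/-! Everything follows from the explicit equation `∑ i, fermi (h * ℓ i) = 1 / 2` for the entropy h.
When it holds, the vector with entries `fermi (h * ℓ e.1)`, indexed by directed edges, is a positive
fixed vector of the non-backtracking transfer matrix with row weights exp(-hℓ(e)). Induction on
words then counts reduced words between constant and linear multiples of exp(ht), and `entropy_eq`
identifies h.

Write p_i = `fermi (ℓ i)`. The unit entropy locus becomes the open simplex 0 < p_i, ∑ p_i = 1/2, and
ℓ i → 0 means p_i → 1/2, that is, q = 1 - 2p_i → 0. Differentiating the equation twice along a line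
gives the Hessian on tangent vectors as a quotient (`fderiv_fderiv_entropy_apply`). Its denominator
is at most r q (1 - log q) (`denominator_le`), and its numerator is at least (dp_i)²/q
(`le_numerator`). Hence the norm is at least |dp_i| / (√r q √(1 - log q)), which is the absolute
differential of `potential`. Since `potential` is of order √(-log q), it diverges as q → 0, so every
path towards ℓ i = 0 is long. -/

namespace EntropyMetric

/-! ### The logistic function and path lengths. -/

/-- The logistic function `x ↦ 1 / (1 + eˣ)`. -/
noncomputable def fermi (x : ℝ) : ℝ := (1 + Real.exp x)⁻¹

lemma fermi_pos (x : ℝ) : 0 < fermi x := by unfold fermi; positivity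

lemma exp_mul_fermi (x : ℝ) : Real.exp x * fermi x = 1 - fermi x := by
  unfold fermi; field_simp; ring

lemma fermi_lt_one (x : ℝ) : fermi x < 1 := by
  have := exp_mul_fermi x
  have := mul_pos (Real.exp_pos x) (fermi_pos x)
  linarith

lemma fermi_strictAnti : StrictAnti fermi := by
  intro x y h
  unfold fermi
  have := Real.exp_lt_exp.2 h
  gcongr

lemma fermi_zero : fermi 0 = 1 / 2 := by norm_num [fermi]

lemma fermi_lt_half {x : ℝ} (hx : 0 < x) : fermi x < 1 / 2 := by
  rw [← fermi_zero]; exact fermi_strictAnti hx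

lemma hasDerivAt_fermi (x : ℝ) : HasDerivAt fermi (-(fermi x * (1 - fermi x))) x := by
  have h : HasDerivAt (fun x => 1 + Real.exp x) (Real.exp x) x := (Real.hasDerivAt_exp x).const_add 1
  have h2 := h.inv (by positivity)
  have : -(fermi x * (1 - fermi x)) = -Real.exp x / (1 + Real.exp x) ^ 2 := by
    rw [← exp_mul_fermi]; unfold fermi; field_simp
  rw [this]; exact h2

lemma contDiff_fermi : ContDiff ℝ ω fermi := by
  unfold fermi
  exact (contDiff_const.add Real.contDiff_exp).inv fun x => by positivity

lemma continuous_fermi : Continuous fermi := contDiff_fermi.continuous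

lemma tendsto_fermi_atTop : Tendsto fermi atTop (𝓝 0) :=
  tendsto_inv_atTop_zero.comp (tendsto_atTop_add_const_left _ _ Real.tendsto_exp_atTop)

lemma rev_rev {E : Type*} (e : DirEdge E) : rev (rev e) = e := by simp [rev]

lemma pathLen_cons {E : Type*} (ℓ : E → ℝ) (e : DirEdge E) (p : List (DirEdge E)) :
    OrientedGraph.pathLen ℓ (e :: p) = ℓ e.1 + OrientedGraph.pathLen ℓ p := by
  simp [OrientedGraph.pathLen]

lemma length_mul_le_pathLen {E : Type*} {ℓ : E → ℝ} {m : ℝ} (hm : ∀ i, m ≤ ℓ i) (p : List (DirEdge E)) :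
    p.length * m ≤ OrientedGraph.pathLen ℓ p := by
  induction p with
  | nil => simp [OrientedGraph.pathLen]
  | cons e p ih =>
    rw [pathLen_cons, List.length_cons]
    push_cast
    linarith [hm e.1]

lemma sum_dirEdge_fermi {E : Type*} [Fintype E] (ℓ : E → ℝ) : ∑ e : DirEdge E, fermi (ℓ e.1) = 2 * ∑ i, fermi (ℓ i) := by
  rw [Fintype.sum_prod_type, Finset.mul_sum]
  simp [two_mul]

/-! ### Counting reduced words with the fixed vector of the transfer matrix. -/

section Counting

variable {E : Type*} [Fintype E] [DecidableEq E]

/-- This is the eigenvector equation: removing one entry from a total of 1 leaves 1 - v, and the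
logistic function satisfies 1 - v = exp(x) v. An edge and its reverse have equal entries. -/
lemma sum_erase_rev_fermi {ℓ : E → ℝ} (h : ∑ e : DirEdge E, fermi (ℓ e.1) = 1) (e : DirEdge E) :
    ∑ e' ∈ Finset.univ.erase (rev e), fermi (ℓ e'.1) = Real.exp (ℓ e.1) * fermi (ℓ e.1) := by
  have := Finset.add_sum_erase Finset.univ (fun e : DirEdge E => fermi (ℓ e.1))
    (Finset.mem_univ (rev e))
  rw [h] at this
  rw [exp_mul_fermi]
  simp only [rev] at this ⊢
  linarith

lemma sum_erase_rev_fermi_mul_exp {ℓ : E → ℝ} {h : ℝ}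
    (hs : ∑ e : DirEdge E, fermi (h * ℓ e.1) = 1) (t : ℝ) (e : DirEdge E) :
    ∑ e' ∈ Finset.univ.erase (rev e), fermi (h * ℓ e'.1) * Real.exp (h * (t - ℓ e.1)) =
      fermi (h * ℓ e.1) * Real.exp (h * t) := by
  rw [← Finset.sum_mul, sum_erase_rev_fermi (ℓ := fun i => h * ℓ i) hs, mul_sub, Real.exp_sub]
  field_simp

/-- Upper bound for the number of reduced words with a given first letter. -/
lemma exists_cover_reduced {ℓ : E → ℝ} {h : ℝ} (hℓ : ∀ i, 0 ≤ ℓ i) (hh : 0 ≤ h)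
    (hs : ∑ e : DirEdge E, fermi (h * ℓ e.1) = 1) (n : ℕ) : ∀ (t : ℝ) (e : DirEdge E),
    ∃ S : Finset (List (DirEdge E)), (∀ p : List (DirEdge E),
      (e :: p).IsChain (fun e e' => e ≠ rev e') → (e :: p).length ≤ n →
      OrientedGraph.pathLen ℓ (e :: p) ≤ t → (e :: p) ∈ S) ∧
      (S.card : ℝ) ≤ 2 * n * (fermi (h * ℓ e.1) * Real.exp (h * t)) := by
  induction n with
  | zero => intro t e; exact ⟨∅, by simp, by simp⟩
  | succ n ih =>
    intro t e
    have hv := fermi_pos (h * ℓ e.1)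
    by_cases het : ℓ e.1 ≤ t
    · choose S hS hc using ih (t - ℓ e.1)
      refine ⟨insert [e] ((Finset.univ.erase (rev e)).biUnion
        fun e' => (S e').image (List.cons e)), ?_, ?_⟩
      · rintro (_ | ⟨e', p⟩) hp hl ht
        · simp
        · rw [List.isChain_cons_cons] at hp
          refine Finset.mem_insert_of_mem (Finset.mem_biUnion.2 ⟨e', ?_, ?_⟩)
          · refine Finset.mem_erase.2 ⟨?_, Finset.mem_univ _⟩
            rintro rfl
            exact hp.1 (rev_rev e).symm
          · refine Finset.mem_image_of_mem _ (hS e' p hp.2 (by simpa using hl) ?_)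
            rw [pathLen_cons] at ht
            linarith
      · have h1 : ((insert [e] ((Finset.univ.erase (rev e)).biUnion
            fun e' => (S e').image (List.cons e))).card : ℝ) ≤
            1 + ∑ e' ∈ Finset.univ.erase (rev e), ((S e').card : ℝ) := by
          have h2 : ((Finset.univ.erase (rev e)).biUnion
            fun e' => (S e').image (List.cons e)).card ≤
              ∑ e' ∈ Finset.univ.erase (rev e), (S e').card :=
            Finset.card_biUnion_le.trans (Finset.sum_le_sum fun _ _ => Finset.card_image_le)
          have h3 := Finset.card_insert_le [e] ((Finset.univ.erase (rev e)).biUnion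
            fun e' => (S e').image (List.cons e))
          rw [add_comm]
          exact_mod_cast h3.trans (Nat.add_le_add_right h2 1)
        have h4 : ∑ e' ∈ Finset.univ.erase (rev e), ((S e').card : ℝ) ≤
            2 * n * (fermi (h * ℓ e.1) * Real.exp (h * t)) := by
          rw [← sum_erase_rev_fermi_mul_exp hs, Finset.mul_sum]
          exact Finset.sum_le_sum fun e' _ => hc e'
        -- The one-letter word is absorbed by the factor 2: since ℓ(e) ≤ t, v exp(ht) ≥ v exp(hℓ(e))
        -- = 1 - v ≥ 1/2.
        have h5 : 1 ≤ 2 * (fermi (h * ℓ e.1) * Real.exp (h * t)) := by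
          have h6 : fermi (h * ℓ e.1) ≤ 1 / 2 := by
            rw [← fermi_zero]
            exact fermi_strictAnti.antitone (mul_nonneg hh (hℓ _))
          have h7 := exp_mul_fermi (h * ℓ e.1)
          have h8 : Real.exp (h * ℓ e.1) ≤ Real.exp (h * t) := by gcongr
          nlinarith
        push_cast
        linarith
    · refine ⟨∅, fun p _ _ ht => absurd ht ?_, by simp; positivity⟩
      have := length_mul_le_pathLen hℓ p
      rw [pathLen_cons]
      simp only [mul_zero] at this
      linarith

/-- Lower bound for the number of reduced words with a given first letter. -/
lemma exists_many_reduced {ℓ : E → ℝ} {h m M : ℝ} (hm : ∀ i, m ≤ ℓ i)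
    (hM : ∀ i, ℓ i ≤ M) (hh : 0 ≤ h)
    (hs : ∑ e : DirEdge E, fermi (h * ℓ e.1) = 1) (n : ℕ) : ∀ t : ℝ, 0 ≤ t → t < n * m →
    ∀ e : DirEdge E, ∃ S : Finset (List (DirEdge E)), (∀ p ∈ S, p.head? = some e ∧
      p.IsChain (fun e e' => e ≠ rev e') ∧ OrientedGraph.pathLen ℓ p ≤ t + M) ∧
      fermi (h * ℓ e.1) * Real.exp (h * t) ≤ S.card := by
  induction n with
  | zero => intro t ht ht'; simp at ht'; linarith
  | succ n ih =>
    intro t ht htn e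
    have hv := fermi_pos (h * ℓ e.1)
    by_cases het : ℓ e.1 ≤ t
    · choose S hS hc using ih (t - ℓ e.1) (by linarith) (by push_cast at htn; linarith [hm e.1])
      refine ⟨(Finset.univ.erase (rev e)).biUnion fun e' => (S e').image (List.cons e), ?_, ?_⟩
      · intro p hp
        obtain ⟨e', he', hp⟩ := Finset.mem_biUnion.1 hp
        obtain ⟨q, hq, rfl⟩ := Finset.mem_image.1 hp
        obtain ⟨h1, h2, h3⟩ := hS e' q hq
        obtain ⟨p, rfl⟩ : ∃ p', q = e' :: p' := by
          cases q with
          | nil => simp at h1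
          | cons a p => simp at h1; exact ⟨p, by rw [h1]⟩
        refine ⟨rfl, List.isChain_cons_cons.2 ⟨?_, h2⟩, ?_⟩
        · rintro rfl
          exact (Finset.mem_erase.1 he').1 (rev_rev e').symm
        · rw [pathLen_cons]; linarith
      · rw [Finset.card_biUnion]
        · rw [← sum_erase_rev_fermi_mul_exp hs]
          push_cast
          refine Finset.sum_le_sum fun e' _ => (hc e').trans_eq ?_
          rw [Finset.card_image_of_injective _ List.cons_injective]
        · intro a _ b _ hab
          rw [Function.onFun, Finset.disjoint_left]
          intro p hp hp'
          obtain ⟨q, hq, rfl⟩ := Finset.mem_image.1 hp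
          obtain ⟨q', hq', h4⟩ := Finset.mem_image.1 hp'
          obtain rfl := List.cons_injective h4
          exact hab (Option.some_injective _ ((hS a _ hq).1.symm.trans (hS b _ hq').1))
    -- Words stop at the first letter that passes t, so the overshoot is at most M. Here one word is
    -- enough because v exp(ht) ≤ v exp(hℓ(e)) = 1 - v ≤ 1.
    · refine ⟨{[e]}, ?_, ?_⟩
      · intro p hp
        rw [Finset.mem_singleton] at hp
        subst hp
        refine ⟨rfl, List.isChain_singleton _, ?_⟩
        simp only [OrientedGraph.pathLen, List.map_cons, List.map_nil, List.sum_cons, List.sum_nil]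
        linarith [hM e.1]
      · have h7 := exp_mul_fermi (h * ℓ e.1)
        have h8 : Real.exp (h * t) ≤ Real.exp (h * ℓ e.1) :=
          Real.exp_le_exp.2 (mul_le_mul_of_nonneg_left (not_le.1 het).le hh)
        simp only [Finset.card_singleton, Nat.cast_one]
        nlinarith

end Counting

lemma rose_isBasedCircuit_iff {r : ℕ} (p : List (DirEdge (Fin r))) :
    (rose r).IsBasedCircuit p ↔ p.IsChain (fun e e' => e ≠ rev e') ∧
      ∃ h : p ≠ [], p.getLast h ≠ rev (p.head h) := by
  unfold OrientedGraph.IsBasedCircuit OrientedGraph.IsReducedPath OrientedGraph.IsEdgePath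
  have h : p.IsChain fun e e' => (rose r).term e = (rose r).orig e' :=
    List.Pairwise.isChain (List.pairwise_of_forall fun _ _ => rfl)
  constructor
  · rintro ⟨⟨_, h1⟩, h2, _, h3⟩; exact ⟨h1, h2, h3⟩
  · rintro ⟨h1, h2, h3⟩; exact ⟨⟨h, h1⟩, h2, rfl, h3⟩

/-! ### Circuits of the rose and the equation for the entropy. -/

section RoseCounting

variable {r : ℕ} {ℓ : Fin r → ℝ} {h m M : ℝ}

lemma circuits_finite_ncard_le (hm0 : 0 < m) (hm : ∀ i, m ≤ ℓ i) (hh : 0 ≤ h)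
    (hs : ∑ e : DirEdge (Fin r), fermi (h * ℓ e.1) = 1) {t : ℝ} (ht : 0 ≤ t) :
    ((rose r).circuits ℓ t).Finite ∧
      (((rose r).circuits ℓ t).ncard : ℝ) ≤ 2 * (t / m) * Real.exp (h * t) := by
  choose S hS hc using exists_cover_reduced (fun i => hm0.le.trans (hm i)) hh hs ⌊t / m⌋₊ t
  have hsub : (rose r).circuits ℓ t ⊆ (Finset.univ.biUnion S : Finset _) := by
    rintro p ⟨hp, hpt⟩
    rw [rose_isBasedCircuit_iff] at hp
    obtain ⟨hp1, hp2, -⟩ := hp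
    obtain ⟨e, p, rfl⟩ := List.exists_cons_of_ne_nil hp2
    rw [Finset.coe_biUnion]
    refine Set.mem_biUnion (x := e) (by simp) (hS e p hp1 ?_ hpt)
    refine Nat.le_floor ?_
    rw [le_div_iff₀ hm0]
    exact (length_mul_le_pathLen hm _).trans hpt
  refine ⟨(Finset.finite_toSet _).subset hsub, ?_⟩
  have h1 : ((rose r).circuits ℓ t).ncard ≤ ∑ e, (S e).card := by
    refine (Set.ncard_le_ncard hsub (Finset.finite_toSet _)).trans ?_
    rw [Set.ncard_coe_finset]
    exact Finset.card_biUnion_le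
  calc (((rose r).circuits ℓ t).ncard : ℝ) ≤ ∑ e, ((S e).card : ℝ) := by exact_mod_cast h1
    _ ≤ ∑ e : DirEdge (Fin r), 2 * (⌊t / m⌋₊ : ℝ) * (fermi (h * ℓ e.1) * Real.exp (h * t)) :=
      Finset.sum_le_sum fun e _ => hc e
    _ = 2 * (⌊t / m⌋₊ : ℝ) * Real.exp (h * t) := by
      rw [← Finset.mul_sum, ← Finset.sum_mul, hs, one_mul]
    _ ≤ _ := by
      gcongr
      exact Nat.floor_le (by positivity)

/-- A reduced word starting with e is closed up by one further letter that avoids the reverses of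
its last and first letters; this is possible because 2r > 2. Of the 2M subtracted from t, one M pays
for the overshoot and one for the added letter. -/
lemma le_ncard_circuits (hr : 2 ≤ r) (hm0 : 0 < m) (hm : ∀ i, m ≤ ℓ i) (hM : ∀ i, ℓ i ≤ M)
    (hh : 0 ≤ h) (hs : ∑ e : DirEdge (Fin r), fermi (h * ℓ e.1) = 1) (e : DirEdge (Fin r))
    {t : ℝ} (ht : 2 * M ≤ t) :
    fermi (h * ℓ e.1) * Real.exp (h * (t - 2 * M)) ≤ ((rose r).circuits ℓ t).ncard := by
  have hM0 : 0 < M := hm0.trans_le ((hm e.1).trans (hM e.1))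
  obtain ⟨n, hn⟩ := exists_nat_gt ((t - 2 * M) / m)
  rw [div_lt_iff₀ hm0] at hn
  obtain ⟨S, hS, hc⟩ := exists_many_reduced hm hM hh hs n (t - 2 * M) (by linarith) hn e
  have hy : ∀ g : DirEdge (Fin r), ∃ y : DirEdge (Fin r), y ≠ rev g ∧ y ≠ rev e := by
    intro g
    by_contra! hcon
    have : (Finset.univ : Finset (DirEdge (Fin r))) ⊆ {rev g, rev e} := by
      intro y _
      rw [Finset.mem_insert, Finset.mem_singleton]
      by_cases hy : y = rev g
      · exact Or.inl hy
      · exact Or.inr (hcon y hy)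
    have h1 := (Finset.card_le_card this).trans Finset.card_le_two
    simp at h1
    omega
  choose y hy1 hy2 using hy
  refine hc.trans ?_
  have hinj : Set.InjOn (fun p : List (DirEdge (Fin r)) => p ++ [y (p.getLastD e)]) (S : Set _) := by
    intro p _ p' _ hpp
    exact (List.append_inj' hpp rfl).1
  have h1 : (S : Set (List (DirEdge (Fin r)))).ncard ≤ ((rose r).circuits ℓ t).ncard := by
    refine Set.ncard_le_ncard_of_injOn _ ?_ hinj
      (circuits_finite_ncard_le hm0 hm hh hs (by linarith)).1
    intro p hp
    obtain ⟨h1, h2, h3⟩ := hS p hp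
    obtain ⟨p, rfl⟩ : ∃ p', p = e :: p' := by
      cases p with
      | nil => simp at h1
      | cons a p => simp at h1; exact ⟨p, by rw [h1]⟩
    refine ⟨(rose_isBasedCircuit_iff _).2 ⟨?_, by simp, ?_⟩, ?_⟩
    · rw [List.isChain_append]
      refine ⟨h2, List.isChain_singleton _, ?_⟩
      intro a ha b hb
      rw [List.getLastD_eq_getLast?, Option.mem_def.1 ha] at hb
      simp only [List.head?_cons, Option.getD_some, Option.mem_def, Option.some.injEq] at hb
      subst hb
      intro hcon
      apply hy1 a
      rw [hcon, rev_rev]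
      exact congrArg y (by rw [← hcon])
    · simpa using hy2 _
    · have : OrientedGraph.pathLen ℓ [y ((e :: p).getLastD e)] ≤ M := by
        simpa [OrientedGraph.pathLen] using hM _
      have h4 : ∀ a b : List (DirEdge (Fin r)), OrientedGraph.pathLen ℓ (a ++ b) =
        OrientedGraph.pathLen ℓ a + OrientedGraph.pathLen ℓ b := by
        simp [OrientedGraph.pathLen]
      rw [h4]
      linarith
  rw [Set.ncard_coe_finset] at h1
  exact_mod_cast h1

lemma entropy_eq (hr : 2 ≤ r) (hℓ : ∀ i, 0 < ℓ i) (hh : 0 ≤ h)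
    (hs : ∑ i, fermi (h * ℓ i) = 1 / 2) : (rose r).entropy ℓ = h := by
  have hs' : ∑ e : DirEdge (Fin r), fermi (h * ℓ e.1) = 1 := by
    rw [sum_dirEdge_fermi (fun i => h * ℓ i), hs]; norm_num
  have i0 : Fin r := ⟨0, by omega⟩
  have : Nonempty (Fin r) := ⟨i0⟩
  obtain ⟨a, ha⟩ := Finite.exists_min ℓ
  obtain ⟨b, hb⟩ := Finite.exists_max ℓ
  set m := ℓ a
  set M := ℓ b
  have hm0 : 0 < m := hℓ a
  have hM0 : 0 < M := hℓ b
  set c := fermi (h * ℓ i0)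
  have hc : 0 < c := fermi_pos _
  refine Tendsto.limUnder_eq ?_
  have hlow : Tendsto (fun t : ℝ => h + (Real.log c - 2 * M * h) / t) atTop (𝓝 (h + 0)) :=
    tendsto_const_nhds.add (tendsto_const_nhds.div_atTop tendsto_id)
  have hup : Tendsto (fun t : ℝ => h + (Real.log (2 / m) / t + Real.log t / t)) atTop
      (𝓝 (h + (0 + 0))) := by
    refine tendsto_const_nhds.add ((tendsto_const_nhds.div_atTop tendsto_id).add ?_)
    exact Real.isLittleO_log_id_atTop.tendsto_div_nhds_zero
  simp only [add_zero] at hlow hup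
  have hpos : ∀ t : ℝ, 2 * M ≤ t → 0 < (((rose r).circuits ℓ t).ncard : ℝ) := fun t ht =>
    (by positivity : 0 < c * Real.exp (h * (t - 2 * M))).trans_le
      (le_ncard_circuits hr hm0 ha hb hh hs' (i0, true) ht)
  refine tendsto_of_tendsto_of_tendsto_of_le_of_le' hlow hup ?_ ?_
  · filter_upwards [eventually_ge_atTop (2 * M)] with t ht
    have ht0 : 0 < t := by linarith
    have h1 := Real.log_le_log (by positivity)
      (le_ncard_circuits hr hm0 ha hb hh hs' (i0, true) ht)
    rw [Real.log_mul hc.ne' (by positivity), Real.log_exp] at h1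
    rw [← sub_nonneg]
    have : 1 / t * Real.log (((rose r).circuits ℓ t).ncard : ℝ) -
      (h + (Real.log c - 2 * M * h) / t) =
      (Real.log (((rose r).circuits ℓ t).ncard : ℝ) - (Real.log c + h * (t - 2 * M))) / t := by
      field_simp; ring
    rw [this]
    exact div_nonneg (by linarith) ht0.le
  · filter_upwards [eventually_ge_atTop (2 * M)] with t ht
    have ht0 : 0 < t := by linarith
    have h1 := Real.log_le_log (hpos t ht) (circuits_finite_ncard_le hm0 ha hh hs' ht0.le).2
    rw [Real.log_mul (by positivity) (by positivity), Real.log_exp,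
      show 2 * (t / m) = 2 / m * t by ring, Real.log_mul (by positivity) ht0.ne'] at h1
    rw [← sub_nonneg]
    have : h + (Real.log (2 / m) / t + Real.log t / t) -
      1 / t * Real.log (((rose r).circuits ℓ t).ncard : ℝ) =
      (Real.log (2 / m) + Real.log t + h * t -
        Real.log (((rose r).circuits ℓ t).ncard : ℝ)) / t := by
      field_simp; ring
    rw [this]
    exact div_nonneg (by linarith) ht0.le

lemma exists_pos_sum_fermi_eq (hr : 2 ≤ r) (hℓ : ∀ i, 0 < ℓ i) :
    ∃ h, 0 < h ∧ ∑ i, fermi (h * ℓ i) = 1 / 2 := by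
  have hcont : Continuous fun s : ℝ => ∑ i, fermi (s * ℓ i) :=
    continuous_finsetSum _ fun i _ => continuous_fermi.comp (continuous_id.mul continuous_const)
  have hlim : Tendsto (fun s : ℝ => ∑ i, fermi (s * ℓ i)) atTop (𝓝 (∑ _i : Fin r, 0)) :=
    tendsto_finsetSum _ fun i _ => tendsto_fermi_atTop.comp (tendsto_id.atTop_mul_const (hℓ i))
  rw [Finset.sum_const_zero] at hlim
  obtain ⟨b, hb, hb0⟩ := ((hlim.eventually_lt_const (by norm_num : (0 : ℝ) < 1 / 2)).and
    (eventually_gt_atTop 0)).exists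
  have h0 : (1 : ℝ) / 2 < ∑ i, fermi (0 * ℓ i) := by
    simp only [zero_mul, fermi_zero, Finset.sum_const, Finset.card_univ, Fintype.card_fin,
      nsmul_eq_mul]
    have : (2 : ℝ) ≤ r := by exact_mod_cast hr
    linarith
  obtain ⟨s, hs, hs'⟩ := intermediate_value_Icc' hb0.le hcont.continuousOn ⟨hb.le, h0.le⟩
  refine ⟨s, lt_of_le_of_ne hs.1 ?_, hs'⟩
  rintro rfl
  simp only at hs'
  linarith

lemma entropy_spec (hr : 2 ≤ r) (hℓ : ∀ i, 0 < ℓ i) :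
    0 < (rose r).entropy ℓ ∧ ∑ i, fermi ((rose r).entropy ℓ * ℓ i) = 1 / 2 := by
  obtain ⟨h, hh, hs⟩ := exists_pos_sum_fermi_eq hr hℓ
  rw [entropy_eq hr hℓ hh.le hs]
  exact ⟨hh, hs⟩

lemma mem_unitEntropy_iff (hr : 2 ≤ r) :
    ℓ ∈ (rose r).unitEntropy ↔ (∀ i, 0 < ℓ i) ∧ ∑ i, fermi (ℓ i) = 1 / 2 := by
  refine ⟨fun ⟨h1, h2⟩ => ⟨h1, ?_⟩, fun ⟨h1, h2⟩ => ⟨h1, ?_⟩⟩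
  · simpa [h2] using (entropy_spec hr h1).2
  · exact entropy_eq hr h1 zero_le_one (by simpa using h2)

end RoseCounting

/-! ### Smoothness of the entropy and its Hessian on tangent vectors. -/

section Smoothness

variable {r : ℕ} {ℓ : Fin r → ℝ}

lemma fermi_mul_one_sub_pos (x : ℝ) : 0 < fermi x * (1 - fermi x) :=
  mul_pos (fermi_pos x) (sub_pos.2 (fermi_lt_one x))

lemma hasDerivAt_fermi_mul_one_sub (x : ℝ) :
    HasDerivAt (fun x => fermi x * (1 - fermi x))
      (-(fermi x * (1 - fermi x) * (1 - 2 * fermi x))) x := by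
  refine ((hasDerivAt_fermi x).mul ((hasDerivAt_fermi x).const_sub 1)).congr_deriv ?_
  ring

lemma sum_fermi_mul_one_sub_mul_pos (hr : 2 ≤ r) {a : Fin r → ℝ} (hℓ : ∀ i, 0 < ℓ i) :
    0 < ∑ i, fermi (a i) * (1 - fermi (a i)) * ℓ i :=
  Finset.sum_pos (fun i _ => mul_pos (fermi_mul_one_sub_pos _) (hℓ i))
    ⟨⟨0, by omega⟩, Finset.mem_univ _⟩

lemma isInvertible_of_apply_one_ne_zero {L : ℝ →L[ℝ] ℝ} (h : L 1 ≠ 0) : L.IsInvertible := by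
  refine ⟨ContinuousLinearEquiv.unitsEquivAut ℝ (Units.mk0 _ h), ?_⟩
  ext
  simp

lemma eventually_forall_pos (hℓ : ∀ i, 0 < ℓ i) : ∀ᶠ x in 𝓝 ℓ, ∀ i, 0 < x i :=
  eventually_all.2 fun i => (continuous_apply i).continuousAt.eventually (lt_mem_nhds (hℓ i))

/-- The implicit function theorem applies because the sum of logistic terms has negative derivative
in h. Near ℓ the implicit function stays positive, so `entropy_eq` identifies it with the entropy.
-/
lemma contDiffAt_entropy (hr : 2 ≤ r) (hℓ : ∀ i, 0 < ℓ i) :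
    ContDiffAt ℝ ∞ (rose r).entropy ℓ := by
  obtain ⟨hpos, hsum⟩ := entropy_spec hr hℓ
  set h := (rose r).entropy ℓ with hh
  set F : (Fin r → ℝ) × ℝ → ℝ := fun u => ∑ i, fermi (u.2 * u.1 i)
  have hF : ContDiff ℝ ∞ F := ContDiff.sum fun i _ =>
    (contDiff_fermi.of_le le_top).comp (contDiff_snd.mul ((contDiff_apply ℝ ℝ i).comp contDiff_fst))
  have hFu : ContDiffAt ℝ ∞ F (ℓ, h) := hF.contDiffAt
  have hn : (∞ : WithTop ℕ∞) ≠ 0 := by simp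
  have hinv : (fderiv ℝ F (ℓ, h) ∘L .inr ℝ (Fin r → ℝ) ℝ).IsInvertible := by
    refine isInvertible_of_apply_one_ne_zero (ne_of_lt ?_)
    have h1 : HasDerivAt (fun s : ℝ => F (ℓ, s)) (fderiv ℝ F (ℓ, h) (0, 1)) h :=
      (hF.differentiable hn (ℓ, h)).hasFDerivAt.comp_hasDerivAt h
        ((hasDerivAt_const h ℓ).prodMk (hasDerivAt_id h))
    have h2 : HasDerivAt (fun s : ℝ => F (ℓ, s))
        (∑ i, -(fermi (h * ℓ i) * (1 - fermi (h * ℓ i))) * (1 * ℓ i)) h :=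
      HasDerivAt.fun_sum fun i _ =>
        (hasDerivAt_fermi _).comp h ((hasDerivAt_id h).mul_const (ℓ i))
    have h3 : (fderiv ℝ F (ℓ, h) ∘L .inr ℝ (Fin r → ℝ) ℝ) 1 =
        -∑ i, fermi (h * ℓ i) * (1 - fermi (h * ℓ i)) * ℓ i := by
      rw [← Finset.sum_neg_distrib]
      simpa using h1.unique h2
    rw [h3, neg_lt_zero]
    exact sum_fermi_mul_one_sub_mul_pos hr hℓ
  have hc := hFu.contDiffAt_implicitFunction hn hinv
  refine hc.congr_of_eventuallyEq ?_
  have h0 := hFu.implicitFunction_apply_self hn hinv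
  have h4 : ∀ᶠ x in 𝓝 ℓ, 0 < hFu.implicitFunction hn hinv x :=
    hc.continuousAt.eventually (lt_mem_nhds (by simpa [h0] using hpos))
  filter_upwards [hFu.eventually_apply_implicitFunction hn hinv, h4, eventually_forall_pos hℓ]
    with x hx1 hx2 hx3
  exact entropy_eq hr hx3 hx2.le (hx1.trans hsum)

/-- Let η be the entropy along the line ℓ + s v, and differentiate the defining equation in s. At s
= 0 the first derivative and tangency force η' = 0, so in the second derivative all cross terms
vanish and η'' can be solved for. -/
lemma fderiv_fderiv_entropy_apply (hr : 2 ≤ r) (hℓ : ℓ ∈ (rose r).unitEntropy) {v : Fin r → ℝ}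
    (hv : ∑ i, fermi (ℓ i) * (1 - fermi (ℓ i)) * v i = 0) :
    fderiv ℝ (fderiv ℝ (rose r).entropy) ℓ v v =
      (∑ i, fermi (ℓ i) * (1 - fermi (ℓ i)) * (1 - 2 * fermi (ℓ i)) * v i ^ 2) /
        ∑ i, fermi (ℓ i) * (1 - fermi (ℓ i)) * ℓ i := by
  obtain ⟨hpos, hone⟩ := hℓ
  set H := (rose r).entropy
  have hline : ∀ s : ℝ, HasDerivAt (fun s : ℝ => ℓ + s • v) v s := fun s => by
    simpa using ((hasDerivAt_id s).smul_const v).const_add ℓ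
  have hcomp : ∀ (i : Fin r) (s : ℝ), HasDerivAt (fun s : ℝ => ℓ i + s * v i) (v i) s :=
    fun i s => by simpa using ((hasDerivAt_id s).mul_const (v i)).const_add (ℓ i)
  have hev : ∀ᶠ s in 𝓝 (0 : ℝ), ∀ i, 0 < (ℓ + s • v) i :=
    (hline 0).continuousAt.eventually (p := fun x => ∀ i, 0 < x i)
      (by simp only [zero_smul, add_zero]; exact eventually_forall_pos hpos)
  set η : ℝ → ℝ := fun s => H (ℓ + s • v) with hη
  set η' : ℝ → ℝ := fun s => fderiv ℝ H (ℓ + s • v) v with hη'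
  have hd1 : ∀ᶠ s in 𝓝 (0 : ℝ), HasDerivAt η (η' s) s := by
    filter_upwards [hev] with s hs
    exact ((contDiffAt_entropy hr hs).differentiableAt (by simp)).hasFDerivAt.comp_hasDerivAt s
      (hline s)
  have hd2 : HasDerivAt η' (fderiv ℝ (fderiv ℝ H) ℓ v v) 0 := by
    have h1 : DifferentiableAt ℝ (fderiv ℝ H) ℓ := by
      have h2 : ContDiffAt ℝ 1 (fderiv ℝ H) ℓ :=
        (contDiffAt_entropy hr hpos).fderiv_right (by norm_cast)
      exact h2.differentiableAt (by simp)
    have h2 : HasDerivAt (fun s : ℝ => fderiv ℝ H (ℓ + s • v)) (fderiv ℝ (fderiv ℝ H) ℓ v) 0 :=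
      h1.hasFDerivAt.comp_hasDerivAt_of_eq 0 (hline 0) (by simp)
    simpa using h2.clm_apply (hasDerivAt_const 0 v)
  have hη0 : η 0 = 1 := by simpa [hη] using hone
  set D : ℝ → ℝ := fun s => ∑ i, -(fermi (η s * (ℓ i + s * v i)) *
    (1 - fermi (η s * (ℓ i + s * v i)))) * (η' s * (ℓ i + s * v i) + η s * v i) with hD
  have hD0 : D =ᶠ[𝓝 0] fun _ => 0 := by
    have hφ : (fun s => ∑ i, fermi (η s * (ℓ i + s * v i))) =ᶠ[𝓝 0] fun _ => 1 / 2 := by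
      filter_upwards [hev] with s hs
      simpa using (entropy_spec hr hs).2
    filter_upwards [hφ.eventuallyEq_nhds, hd1] with s hs hs1
    have h1 : HasDerivAt (fun s => ∑ i, fermi (η s * (ℓ i + s * v i))) (D s) s :=
      HasDerivAt.fun_sum fun i _ => (hasDerivAt_fermi _).comp s (hs1.mul (hcomp i s))
    exact (h1.congr_of_eventuallyEq hs.symm).unique (hasDerivAt_const s _)
  have hden := sum_fermi_mul_one_sub_mul_pos (ℓ := ℓ) (a := ℓ) hr hpos
  have hη'0 : η' 0 = 0 := by
    have h1 : D 0 = 0 := hD0.self_of_nhds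
    simp only [hD, hη0, zero_mul, add_zero, one_mul] at h1
    have h2 : ∑ i, -(fermi (ℓ i) * (1 - fermi (ℓ i))) * (η' 0 * ℓ i + v i) =
        -(η' 0 * ∑ i, fermi (ℓ i) * (1 - fermi (ℓ i)) * ℓ i) -
          ∑ i, fermi (ℓ i) * (1 - fermi (ℓ i)) * v i := by
      rw [Finset.mul_sum, ← Finset.sum_neg_distrib, ← Finset.sum_sub_distrib]
      exact Finset.sum_congr rfl fun i _ => by ring
    rw [h2, hv, sub_zero, neg_eq_zero] at h1
    exact (mul_eq_zero.1 h1).resolve_right hden.ne'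
  have hDd : HasDerivAt D (∑ i, fermi (ℓ i) * (1 - fermi (ℓ i)) * (1 - 2 * fermi (ℓ i)) * v i ^ 2 -
      fderiv ℝ (fderiv ℝ H) ℓ v v * ∑ i, fermi (ℓ i) * (1 - fermi (ℓ i)) * ℓ i) 0 := by
    have hd0 := hd1.self_of_nhds
    have h1 := HasDerivAt.fun_sum (u := Finset.univ) fun i _ =>
      ((hasDerivAt_fermi_mul_one_sub _).comp 0 (hd0.mul (hcomp i 0))).neg.mul
        ((hd2.mul (hcomp i 0)).add (hd0.mul_const (v i)))
    refine h1.congr_deriv ?_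
    rw [Finset.mul_sum, ← Finset.sum_sub_distrib]
    refine Finset.sum_congr rfl fun i _ => ?_
    simp only [Pi.mul_apply, Pi.add_apply, Pi.neg_apply, Function.comp, hη0, hη'0, zero_mul,
      add_zero, one_mul, zero_add]
    ring
  have h1 := (hDd.congr_of_eventuallyEq hD0.symm).unique (hasDerivAt_const 0 _)
  rw [eq_div_iff hden.ne']
  linarith

end Smoothness

/-! ### Lower bound for the norm by the variation of one coordinate. -/

section NormBound

variable {r : ℕ} {ℓ v : Fin r → ℝ}

/-- The square of the entropy norm at a point of unit entropy, in closed form. -/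
noncomputable def roseForm (ℓ v : Fin r → ℝ) : ℝ :=
  (∑ i, fermi (ℓ i) * (1 - fermi (ℓ i)) * (1 - 2 * fermi (ℓ i)) * v i ^ 2) /
    ∑ i, fermi (ℓ i) * (1 - fermi (ℓ i)) * ℓ i

lemma entropyNorm_eq (hr : 2 ≤ r) (hℓ : ℓ ∈ (rose r).unitEntropy)
    (hv : ∑ i, fermi (ℓ i) * (1 - fermi (ℓ i)) * v i = 0) :
    (rose r).entropyNorm ℓ v = √(roseForm ℓ v) := by
  rw [OrientedGraph.entropyNorm, fderiv_fderiv_entropy_apply hr hℓ hv, roseForm]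

lemma mul_one_sub_log_le {x y : ℝ} (hx : 0 < x) (hxy : x ≤ y) (hy : y ≤ 1) :
    x * (1 - Real.log x) ≤ y * (1 - Real.log y) := by
  have hy0 := hx.trans_le hxy
  have h1 := Real.log_le_sub_one_of_pos (div_pos hy0 hx)
  rw [Real.log_div hy0.ne' hx.ne'] at h1
  have h2 : x * (Real.log y - Real.log x) ≤ y - x := by
    calc x * (Real.log y - Real.log x) ≤ x * (y / x - 1) := by gcongr
      _ = y - x := by field_simp
  nlinarith [mul_nonneg (sub_nonneg.2 hxy) (neg_nonneg.2 (Real.log_nonpos hy0.le hy))]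

lemma log_one_sub_fermi (x : ℝ) : x = Real.log (1 - fermi x) - Real.log (fermi x) := by
  rw [← exp_mul_fermi, Real.log_mul (Real.exp_pos x).ne' (fermi_pos x).ne', Real.log_exp]
  ring

lemma one_sub_two_mul_fermi_pos {x : ℝ} (hx : 0 < x) : 0 < 1 - 2 * fermi x := by
  linarith [fermi_lt_half hx]

lemma one_le_one_sub_log {x : ℝ} (hx : 0 < x) : 1 ≤ 1 - Real.log (1 - 2 * fermi x) := by
  linarith [Real.log_nonpos (one_sub_two_mul_fermi_pos hx).le (by linarith [fermi_pos x])]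

lemma fermi_le_of_ne (hs : ∑ i, fermi (ℓ i) = 1 / 2) {i j : Fin r} (hij : j ≠ i) :
    fermi (ℓ j) ≤ (1 - 2 * fermi (ℓ i)) / 2 := by
  have h1 := Finset.add_sum_erase Finset.univ (fun i => fermi (ℓ i)) (Finset.mem_univ i)
  have h2 : fermi (ℓ j) ≤ ∑ k ∈ Finset.univ.erase i, fermi (ℓ k) :=
    Finset.single_le_sum (f := fun k => fermi (ℓ k)) (fun k _ => (fermi_pos _).le)
      (Finset.mem_erase.2 ⟨hij, Finset.mem_univ j⟩)
  linarith

/-- Each term is at most q (1 - log q). For j = i, p ℓ ≤ p (exp ℓ - 1) = q. For j ≠ i, p_j ≤ q/2 and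
ℓ_j ≤ -log p_j, and x (1 - log x) increases on (0, 1]. -/
lemma denominator_le (hpos : ∀ i, 0 < ℓ i) (hs : ∑ i, fermi (ℓ i) = 1 / 2) (i : Fin r) :
    ∑ j, fermi (ℓ j) * (1 - fermi (ℓ j)) * ℓ j ≤
      r * ((1 - 2 * fermi (ℓ i)) * (1 - Real.log (1 - 2 * fermi (ℓ i)))) := by
  have hq := one_sub_two_mul_fermi_pos (hpos i)
  have hL := one_le_one_sub_log (hpos i)
  set q := 1 - 2 * fermi (ℓ i) with hqdef
  have hterm : ∀ j, fermi (ℓ j) * (1 - fermi (ℓ j)) * ℓ j ≤ q * (1 - Real.log q) := by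
    intro j
    have hp := fermi_pos (ℓ j)
    have hp1 := fermi_lt_one (ℓ j)
    have hmul : fermi (ℓ j) * (1 - fermi (ℓ j)) * ℓ j ≤ fermi (ℓ j) * ℓ j := by
      nlinarith [mul_pos (mul_pos hp hp) (hpos j)]
    refine hmul.trans ?_
    by_cases hij : j = i
    · subst hij
      have h1 := Real.add_one_le_exp (ℓ j)
      have h2 := exp_mul_fermi (ℓ j)
      nlinarith
    · have h1 := fermi_le_of_ne hs hij
      have h2 := log_one_sub_fermi (ℓ j)
      have h3 : Real.log (1 - fermi (ℓ j)) ≤ 0 := Real.log_nonpos (by linarith) (by linarith)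
      refine le_trans ?_ (mul_one_sub_log_le hp (by linarith) (by linarith [fermi_pos (ℓ i)]))
      gcongr
      linarith
  calc _ ≤ ∑ _j : Fin r, q * (1 - Real.log q) := Finset.sum_le_sum fun j _ => hterm j
    _ = _ := by simp

lemma le_numerator (hpos : ∀ i, 0 < ℓ i) (hs : ∑ i, fermi (ℓ i) = 1 / 2)
    (hv : ∑ i, fermi (ℓ i) * (1 - fermi (ℓ i)) * v i = 0) (i : Fin r) :
    (fermi (ℓ i) * (1 - fermi (ℓ i)) * v i) ^ 2 ≤ (1 - 2 * fermi (ℓ i)) *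
      ∑ j, fermi (ℓ j) * (1 - fermi (ℓ j)) * (1 - 2 * fermi (ℓ j)) * v j ^ 2 := by
  have hq := one_sub_two_mul_fermi_pos (hpos i)
  have hnn : ∀ j, 0 ≤ fermi (ℓ j) * (1 - fermi (ℓ j)) * (1 - 2 * fermi (ℓ j)) * v j ^ 2 :=
    fun j => mul_nonneg (mul_pos (fermi_mul_one_sub_pos _)
      (one_sub_two_mul_fermi_pos (hpos j))).le (sq_nonneg _)
  -- If q ≥ 1/2, the i-th term alone suffices, since p(1 - p) = (1 - q²)/4 ≤ q². For small q that
  -- term is too weak, and the tangency relation moves the estimate to the other coordinates.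
  rcases le_total (1 / 2) (1 - 2 * fermi (ℓ i)) with hhalf | hhalf
  · have h1 : fermi (ℓ i) * (1 - fermi (ℓ i)) * (1 - 2 * fermi (ℓ i)) * v i ^ 2 ≤
        ∑ j, fermi (ℓ j) * (1 - fermi (ℓ j)) * (1 - 2 * fermi (ℓ j)) * v j ^ 2 :=
      Finset.single_le_sum (f := fun j =>
        fermi (ℓ j) * (1 - fermi (ℓ j)) * (1 - 2 * fermi (ℓ j)) * v j ^ 2)
        (fun j _ => hnn j) (Finset.mem_univ i)
    refine le_trans ?_ (mul_le_mul_of_nonneg_left h1 hq.le)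
    have h2 : fermi (ℓ i) * (1 - fermi (ℓ i)) ≤ (1 - 2 * fermi (ℓ i)) ^ 2 := by
      nlinarith [sq_nonneg (1 - 2 * fermi (ℓ i))]
    have h3 := mul_nonneg (fermi_mul_one_sub_pos (ℓ i)).le (sq_nonneg (v i))
    nlinarith [mul_le_mul_of_nonneg_left h2 h3]
  · have h1 := Finset.add_sum_erase Finset.univ (fun i => fermi (ℓ i)) (Finset.mem_univ i)
    have h2 := Finset.add_sum_erase Finset.univ
      (fun i => fermi (ℓ i) * (1 - fermi (ℓ i)) * v i) (Finset.mem_univ i)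
    -- Cauchy–Schwarz with weights p_j, whose total over j ≠ i is only q/2. The remaining factor
    -- costs 2, because p_j ≤ q/2 ≤ 1/4 gives 1 - p_j ≤ 2(1 - 2p_j).
    have h3 := Finset.sum_sq_le_sum_mul_sum_of_sq_le_mul (Finset.univ.erase i)
      (r := fun j => fermi (ℓ j) * (1 - fermi (ℓ j)) * v j)
      (f := fun j => fermi (ℓ j)) (g := fun j => fermi (ℓ j) * (1 - fermi (ℓ j)) ^ 2 * v j ^ 2)
      (fun j _ => (fermi_pos _).le)
      (fun j _ => mul_nonneg (mul_nonneg (fermi_pos _).le (sq_nonneg _)) (sq_nonneg _))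
      (fun j _ => le_of_eq (by ring))
    have h4 : ∑ j ∈ Finset.univ.erase i, fermi (ℓ j) * (1 - fermi (ℓ j)) ^ 2 * v j ^ 2 ≤
        2 * ∑ j, fermi (ℓ j) * (1 - fermi (ℓ j)) * (1 - 2 * fermi (ℓ j)) * v j ^ 2 := by
      rw [Finset.mul_sum]
      refine (Finset.sum_le_sum fun j hj => ?_).trans
        (Finset.sum_le_sum_of_subset_of_nonneg (Finset.erase_subset i _)
          fun j _ _ => mul_nonneg zero_le_two (hnn j))
      have h5 := fermi_le_of_ne hs (Finset.mem_erase.1 hj).1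
      have h6 := mul_nonneg (fermi_mul_one_sub_pos (ℓ j)).le (sq_nonneg (v j))
      nlinarith
    have h7 : (fermi (ℓ i) * (1 - fermi (ℓ i)) * v i) ^ 2 =
        (∑ j ∈ Finset.univ.erase i, fermi (ℓ j) * (1 - fermi (ℓ j)) * v j) ^ 2 := by
      rw [← neg_sq]; congr 1; linarith
    have h8 : ∑ j ∈ Finset.univ.erase i, fermi (ℓ j) = (1 - 2 * fermi (ℓ i)) / 2 := by linarith
    rw [h7]
    rw [h8] at h3
    nlinarith [mul_le_mul_of_nonneg_left h4 hq.le]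

lemma le_sqrt_roseForm (hr : 2 ≤ r) (hpos : ∀ i, 0 < ℓ i) (hs : ∑ i, fermi (ℓ i) = 1 / 2)
    (hv : ∑ i, fermi (ℓ i) * (1 - fermi (ℓ i)) * v i = 0) (i : Fin r) :
    |fermi (ℓ i) * (1 - fermi (ℓ i)) * v i /
      (√r * (1 - 2 * fermi (ℓ i)) * √(1 - Real.log (1 - 2 * fermi (ℓ i))))| ≤ √(roseForm ℓ v) := by
  refine Real.abs_le_sqrt ?_
  have hq := one_sub_two_mul_fermi_pos (hpos i)
  have hL := one_le_one_sub_log (hpos i)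
  have h1 := denominator_le hpos hs i
  have h2 := le_numerator hpos hs hv i
  have hden := sum_fermi_mul_one_sub_mul_pos (ℓ := ℓ) (a := ℓ) hr hpos
  have hr0 : (0 : ℝ) < r := by positivity
  rw [roseForm, div_pow, mul_pow (√(r : ℝ) * _), mul_pow (√(r : ℝ)), Real.sq_sqrt hr0.le, Real.sq_sqrt (by linarith)]
  rw [div_le_div_iff₀ (by positivity) hden]
  refine (mul_le_mul h2 h1 hden.le ((sq_nonneg _).trans h2)).trans_eq ?_
  ring

/-- A function of one edge length whose variation bounds entropy lengths from below. -/
noncomputable def potential (r : ℕ) (x : ℝ) : ℝ := √(1 - Real.log (1 - 2 * fermi x)) / √r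

lemma hasDerivAt_potential (r : ℕ) {x : ℝ} (hx : 0 < x) :
    HasDerivAt (potential r) (-(fermi x * (1 - fermi x) /
      (√r * (1 - 2 * fermi x) * √(1 - Real.log (1 - 2 * fermi x))))) x := by
  have hq := one_sub_two_mul_fermi_pos hx
  have hL := one_le_one_sub_log hx
  have h := (((((hasDerivAt_fermi x).const_mul 2).const_sub 1).log hq.ne').const_sub 1).sqrt
    (by linarith) |>.div_const (√r)
  refine h.congr_deriv ?_
  by_cases hr : √(r : ℝ) = 0
  · simp [hr]
  have : √(1 - Real.log (1 - 2 * fermi x)) ≠ 0 := (Real.sqrt_pos.2 (by linarith)).ne'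
  field_simp

lemma potential_anti {x y : ℝ} (hx : 0 < x) (hxy : x ≤ y) : potential r y ≤ potential r x := by
  unfold potential
  have := one_sub_two_mul_fermi_pos hx
  have := fermi_strictAnti.antitone hxy
  gcongr

lemma tendsto_potential (hr : 2 ≤ r) : Tendsto (potential r) (𝓝[>] 0) atTop := by
  have h1 : Tendsto (fun x => 1 - 2 * fermi x) (𝓝[>] 0) (𝓝[>] 0) := by
    refine tendsto_nhdsWithin_iff.2 ⟨?_, ?_⟩
    · have : Continuous fun x => 1 - 2 * fermi x :=
        continuous_const.sub (continuous_const.mul continuous_fermi)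
      have h2 := this.tendsto 0
      rw [fermi_zero] at h2
      norm_num at h2
      exact h2.mono_left nhdsWithin_le_nhds
    · filter_upwards [self_mem_nhdsWithin] with x hx
      exact one_sub_two_mul_fermi_pos hx
  have h2 := Real.tendsto_log_nhdsGT_zero.comp h1
  have h3 := tendsto_atTop_add_const_left _ 1 (tendsto_neg_atBot_atTop.comp h2)
  refine (Real.tendsto_sqrt_atTop.comp h3).atTop_div_const ?_
  have : (0 : ℝ) < r := by positivity
  positivity

end NormBound

/-! ### Lengths of paths, connectedness of the unit entropy locus, and distances. -/

section Paths

variable {r : ℕ}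

lemma intervalIntegrable_entropyNorm_and_potential_sub_le (hr : 2 ≤ r) {γ : ℝ → Fin r → ℝ} {a b : ℝ} (hab : a < b)
    (hγ : ContDiffOn ℝ ∞ γ (Icc a b)) (hmem : ∀ t ∈ Icc a b, γ t ∈ (rose r).unitEntropy)
    (i : Fin r) :
    IntervalIntegrable (fun t => (rose r).entropyNorm (γ t) (deriv γ t)) MeasureTheory.volume a b ∧
      potential r (γ b i) - potential r (γ a i) ≤
        ∫ t in a..b, (rose r).entropyNorm (γ t) (deriv γ t) := by
  have hmem' : ∀ t ∈ Icc a b, (∀ i, 0 < γ t i) ∧ ∑ i, fermi (γ t i) = 1 / 2 := fun t ht =>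
    (mem_unitEntropy_iff hr).1 (hmem t ht)
  set γ' := derivWithin γ (Icc a b)
  have hγc : ContinuousOn γ (Icc a b) := hγ.continuousOn
  have hγ'c : ContinuousOn γ' (Icc a b) :=
    hγ.continuousOn_derivWithin (uniqueDiffOn_Icc hab) (by simp)
  have hder : ∀ t ∈ Ioo a b, HasDerivAt γ (γ' t) t := fun t ht =>
    ((hγ.differentiableOn (by simp) t (Ioo_subset_Icc_self ht)).hasDerivWithinAt).hasDerivAt
      (Icc_mem_nhds ht.1 ht.2)
  have hderi : ∀ t ∈ Ioo a b, ∀ j, HasDerivAt (fun s => γ s j) (γ' t j) t := fun t ht j =>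
    (hasDerivAt_pi.1 (hder t ht)) j
  have htan : ∀ t ∈ Ioo a b, ∑ j, fermi (γ t j) * (1 - fermi (γ t j)) * γ' t j = 0 := by
    intro t ht
    have h1 : HasDerivAt (fun s => ∑ j, fermi (γ s j))
        (∑ j, -(fermi (γ t j) * (1 - fermi (γ t j))) * γ' t j) t :=
      HasDerivAt.fun_sum fun j _ => (hasDerivAt_fermi _).comp t (hderi t ht j)
    have h2 : (fun s => ∑ j, fermi (γ s j)) =ᶠ[𝓝 t] fun _ => 1 / 2 := by
      filter_upwards [Icc_mem_nhds ht.1 ht.2] with s hs using (hmem' s hs).2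
    have h3 := (h1.congr_of_eventuallyEq h2.symm).unique (hasDerivAt_const t _)
    simpa [Finset.sum_neg_distrib] using h3
  have hnorm : ∀ t ∈ Ioo a b,
      √(roseForm (γ t) (γ' t)) = (rose r).entropyNorm (γ t) (deriv γ t) := by
    intro t ht
    rw [(hder t ht).deriv, entropyNorm_eq hr (hmem t (Ioo_subset_Icc_self ht)) (htan t ht)]
  have hcj : ∀ j, ContinuousOn (fun t => γ t j) (Icc a b) := fun j =>
    (continuous_apply j).comp_continuousOn hγc
  have hcj' : ∀ j, ContinuousOn (fun t => γ' t j) (Icc a b) := fun j =>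
    (continuous_apply j).comp_continuousOn hγ'c
  have hfj : ∀ j, ContinuousOn (fun t => fermi (γ t j)) (Icc a b) := fun j =>
    continuous_fermi.comp_continuousOn (hcj j)
  have hcont : ContinuousOn (fun t => √(roseForm (γ t) (γ' t))) (Icc a b) := by
    refine Real.continuous_sqrt.comp_continuousOn (ContinuousOn.div ?_ ?_ ?_)
    · exact continuousOn_finsetSum _ fun j _ => (((hfj j).mul (continuousOn_const.sub (hfj j))).mul
        (continuousOn_const.sub (continuousOn_const.mul (hfj j)))).mul ((hcj' j).pow 2)
    · exact continuousOn_finsetSum _ fun j _ =>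
        ((hfj j).mul (continuousOn_const.sub (hfj j))).mul (hcj j)
    · exact fun t ht => (sum_fermi_mul_one_sub_mul_pos hr (hmem' t ht).1).ne'
  -- `deriv γ` may be wrong at the endpoints, a null set; inside, the integrand agrees with a
  -- function continuous on the closed interval. Integrability is essential, as a non-integrable
  -- speed would have integral 0.
  have hint : MeasureTheory.IntegrableOn
      (fun t => (rose r).entropyNorm (γ t) (deriv γ t)) (Icc a b) := by
    rw [integrableOn_Icc_iff_integrableOn_Ioo]
    exact (hcont.integrableOn_Icc.mono_set Ioo_subset_Icc_self).congr_fun hnorm measurableSet_Ioo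
  refine ⟨(intervalIntegrable_iff_integrableOn_Icc_of_le hab.le).2 hint, ?_⟩
  have hpd : ∀ t ∈ Icc a b, HasDerivAt (potential r) _ (γ t i) := fun t ht =>
    hasDerivAt_potential r ((hmem' t ht).1 i)
  have hcpot : ContinuousOn (fun t => potential r (γ t i)) (Icc a b) := fun t ht =>
    ContinuousAt.comp_continuousWithinAt (f := fun t => γ t i) (hpd t ht).continuousAt (hcj i t ht)
  have hdpot : ∀ t ∈ Ioo a b, HasDerivAt (fun t => potential r (γ t i)) _ t := fun t ht =>
    HasDerivAt.comp (h := fun t => γ t i) t (hpd t (Ioo_subset_Icc_self ht)) (hderi t ht i)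
  refine intervalIntegral.sub_le_integral_of_hasDeriv_right_of_le hab.le hcpot
    (fun t ht => (hdpot t ht).hasDerivWithinAt) hint ?_
  intro t ht
  have ht' := hmem' t (Ioo_subset_Icc_self ht)
  rw [← hnorm t ht]
  refine le_trans ?_ (le_sqrt_roseForm hr ht'.1 ht'.2 (htan t ht) i)
  refine le_trans (le_of_eq ?_) (neg_le_abs _)
  ring

lemma potential_sub_le_entropyLength (hr : 2 ≤ r) {γ : ℝ → Fin r → ℝ} (hγ : IsPiecewiseSmooth γ)
    (hmem : ∀ t ∈ Icc (0 : ℝ) 1, γ t ∈ (rose r).unitEntropy) (i : Fin r) :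
    potential r (γ 1 i) - potential r (γ 0 i) ≤ (rose r).entropyLength γ := by
  obtain ⟨-, n, t, hmono, h0, h1, hsm⟩ := hγ
  -- The partition is reindexed by ℕ for telescoping; the reduction modulo n + 1 has no effect on
  -- indices up to n.
  set τ : ℕ → ℝ := fun k => t (Fin.ofNat (n + 1) k) with hτ
  have hτc : ∀ (k : ℕ) (hk : k < n), τ k = t (Fin.castSucc ⟨k, hk⟩) := fun k hk =>
    congrArg t (Fin.ext (by simp [Fin.ofNat]; omega))
  have hτs : ∀ (k : ℕ) (hk : k < n), τ (k + 1) = t (Fin.succ ⟨k, hk⟩) := fun k hk =>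
    congrArg t (Fin.ext (by simp [Fin.ofNat]; omega))
  have hτ0 : τ 0 = 0 := h0
  have hτn : τ n = 1 := by
    rw [← h1]
    exact congrArg t (Fin.ext (by simp [Fin.ofNat]))
  have hpiece : ∀ k < n, IntervalIntegrable (fun s => (rose r).entropyNorm (γ s) (deriv γ s))
      MeasureTheory.volume (τ k) (τ (k + 1)) ∧
      potential r (γ (τ (k + 1)) i) - potential r (γ (τ k) i) ≤
        ∫ s in (τ k)..(τ (k + 1)), (rose r).entropyNorm (γ s) (deriv γ s) := by
    intro k hk
    rw [hτc k hk, hτs k hk]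
    refine intervalIntegrable_entropyNorm_and_potential_sub_le hr (hmono Fin.castSucc_lt_succ) (hsm ⟨k, hk⟩) (fun s hs => hmem s ?_) i
    refine ⟨le_trans ?_ hs.1, hs.2.trans ?_⟩
    · rw [← h0]; exact hmono.monotone (Fin.zero_le _)
    · rw [← h1]; exact hmono.monotone (Fin.le_last _)
  have hsum := intervalIntegral.sum_integral_adjacent_intervals fun k hk => (hpiece k hk).1
  rw [hτ0, hτn] at hsum
  rw [OrientedGraph.entropyLength, ← hsum]
  have htel := Finset.sum_range_sub (fun k => potential r (γ (τ k) i)) n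
  simp only [hτ0, hτn] at htel
  rw [← htel]
  exact Finset.sum_le_sum fun k hk => (hpiece k (Finset.mem_range.1 hk)).2

/-- The inverse of the logistic function. -/
noncomputable def logit (p : ℝ) : ℝ := Real.log (1 - p) - Real.log p

lemma logit_fermi (x : ℝ) : logit (fermi x) = x := (log_one_sub_fermi x).symm

lemma fermi_logit {p : ℝ} (h0 : 0 < p) (h1 : p < 1) : fermi (logit p) = p := by
  rw [fermi, logit, Real.exp_sub, Real.exp_log h0, Real.exp_log (by linarith)]
  field_simp
  ring

lemma logit_pos {p : ℝ} (h0 : 0 < p) (h1 : p < 1 / 2) : 0 < logit p :=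
  sub_pos.2 (Real.log_lt_log h0 (by linarith))

/-- In the coordinates p_i the locus is convex, so a straight segment works. Existence matters
because the infimum over an empty set of lengths would be 0. -/
lemma exists_path (hr : 2 ≤ r) {x y : Fin r → ℝ} (hx : x ∈ (rose r).unitEntropy)
    (hy : y ∈ (rose r).unitEntropy) :
    ∃ γ : ℝ → Fin r → ℝ, IsPiecewiseSmooth γ ∧
      (∀ t ∈ Icc (0 : ℝ) 1, γ t ∈ (rose r).unitEntropy) ∧ γ 0 = x ∧ γ 1 = y := by
  obtain ⟨hx0, hxs⟩ := (mem_unitEntropy_iff hr).1 hx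
  obtain ⟨hy0, hys⟩ := (mem_unitEntropy_iff hr).1 hy
  set p : ℝ → Fin r → ℝ := fun t i => fermi (x i) + t * (fermi (y i) - fermi (x i)) with hp
  have hmem : ∀ t ∈ Icc (0 : ℝ) 1, ∀ i, p t i ∈ Ioo (0 : ℝ) (1 / 2) := fun t ht i =>
    (convex_Ioo (0 : ℝ) (1 / 2)).add_smul_sub_mem ⟨fermi_pos _, fermi_lt_half (hx0 i)⟩
      ⟨fermi_pos _, fermi_lt_half (hy0 i)⟩ ht
  have hsmooth : ContDiffOn ℝ ∞ (fun t i => logit (p t i)) (Icc 0 1) := by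
    refine contDiffOn_pi.2 fun i => ?_
    have hpi : ContDiffOn ℝ ∞ (fun t => p t i) (Icc 0 1) := by
      simp only [hp]
      fun_prop
    refine ((contDiffOn_const.sub hpi).log fun t ht => ?_).sub (hpi.log fun t ht => ?_)
    · linarith [(hmem t ht i).2]
    · exact (hmem t ht i).1.ne'
  refine ⟨fun t i => logit (p t i), ⟨hsmooth.continuousOn, 1, ![0, 1], ?_, rfl, rfl, ?_⟩, ?_, ?_, ?_⟩
  · rw [Fin.strictMono_iff_lt_succ]
    intro k
    fin_cases k
    simp
  · intro k
    fin_cases k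
    simpa using hsmooth
  · intro t ht
    refine (mem_unitEntropy_iff hr).2 ⟨fun i => logit_pos (hmem t ht i).1 (hmem t ht i).2, ?_⟩
    have h1 : ∀ i, fermi (logit (p t i)) = p t i := fun i =>
      fermi_logit (hmem t ht i).1 (by linarith [(hmem t ht i).2])
    simp only [h1]
    simp only [hp]
    rw [Finset.sum_add_distrib, ← Finset.mul_sum, Finset.sum_sub_distrib, hxs, hys]
    ring
  · funext i
    simp [hp, logit_fermi]
  · funext i
    simp [hp, logit_fermi]

lemma potential_sub_le_entropyDist (hr : 2 ≤ r) {x y : Fin r → ℝ}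
    (hx : x ∈ (rose r).unitEntropy) (hy : y ∈ (rose r).unitEntropy) (i : Fin r) :
    potential r (y i) - potential r (x i) ≤ (rose r).entropyDist x y := by
  obtain ⟨γ, hγ, hmem, h0, h1⟩ := exists_path hr hx hy
  refine le_csInf ⟨_, γ, hγ, hmem, h0, h1, rfl⟩ ?_
  rintro L ⟨γ, hγ, hmem, rfl, rfl, rfl⟩
  exact potential_sub_le_entropyLength hr hγ hmem i

lemma exists_mem_unitEntropy_apply_eq (hr : 2 ≤ r) (i : Fin r) {ε : ℝ} (hε : 0 < ε) :
    ∃ ℓ ∈ (rose r).unitEntropy, ℓ i = ε := by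
  have hr1 : (0 : ℝ) < r - 1 := by
    have : (2 : ℝ) ≤ r := by exact_mod_cast hr
    linarith
  -- The mass left over by coordinate i is shared equally among the other r - 1 coordinates.
  set p := (1 / 2 - fermi ε) / (r - 1) with hp
  have hlt := fermi_lt_half hε
  have hp0 : 0 < p := div_pos (by linarith) hr1
  have hp1 : p < 1 / 2 := by
    have : (2 : ℝ) ≤ r := by exact_mod_cast hr
    rw [hp, div_lt_iff₀ hr1]
    linarith [fermi_pos ε]
  refine ⟨fun j => if j = i then ε else logit p, (mem_unitEntropy_iff hr).2 ⟨fun j => ?_, ?_⟩,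
    by simp⟩
  · by_cases hj : j = i
    · simpa [hj] using hε
    · simpa [hj] using logit_pos hp0 hp1
  · have h1 : ∀ j : Fin r, fermi (if j = i then ε else logit p) =
        p + if j = i then fermi ε - p else 0 := by
      intro j
      split_ifs
      · ring
      · rw [fermi_logit hp0 (by linarith), add_zero]
    simp only [h1, Finset.sum_add_distrib, Finset.sum_ite_eq', Finset.mem_univ, if_true,
      Finset.sum_const, Finset.card_univ, Fintype.card_fin, nsmul_eq_mul]
    rw [hp]
    field_simp
    ring

lemma const_mem_unitEntropy (hr : 2 ≤ r) :
    (fun _ : Fin r => Real.log (2 * (r : ℝ) - 1)) ∈ (rose r).unitEntropy := by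
  have h2 : (2 : ℝ) ≤ r := by exact_mod_cast hr
  refine (mem_unitEntropy_iff hr).2 ⟨fun _ => Real.log_pos (by linarith), ?_⟩
  rw [fermi, Real.exp_log (by linarith)]
  simp
  field_simp

end Paths

end EntropyMetric

theorem proposition7p16 (r : ℕ) (hr : 2 ≤ r) :
    (fun _ : Fin r => Real.log (2 * (r : ℝ) - 1)) ∈ (EntropyMetric.rose r).unitEntropy ∧
    (∀ D : ℝ, 0 < D → ∃ ε : ℝ, 0 < ε ∧ ∀ ℓ ∈ (EntropyMetric.rose r).unitEntropy,
      (∃ i : Fin r, ℓ i ≤ ε) →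
        D ≤ (EntropyMetric.rose r).entropyDist (fun _ => Real.log (2 * (r : ℝ) - 1)) ℓ) ∧
    ¬ BddAbove {d : ℝ | ∃ x ∈ (EntropyMetric.rose r).unitEntropy,
      ∃ y ∈ (EntropyMetric.rose r).unitEntropy, d = (EntropyMetric.rose r).entropyDist x y} := by
  have hone := EntropyMetric.const_mem_unitEntropy hr
  have hfar : ∀ D : ℝ, ∃ ε : ℝ, 0 < ε ∧ ∀ ℓ ∈ (EntropyMetric.rose r).unitEntropy,
      (∃ i : Fin r, ℓ i ≤ ε) →
        D ≤ (EntropyMetric.rose r).entropyDist (fun _ => Real.log (2 * (r : ℝ) - 1)) ℓ := by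
    intro D
    obtain ⟨ε, hε, hε0⟩ := (((EntropyMetric.tendsto_potential hr).eventually_ge_atTop
      (D + EntropyMetric.potential r (Real.log (2 * (r : ℝ) - 1)))).and self_mem_nhdsWithin).exists
    refine ⟨ε, hε0, fun ℓ hℓ ⟨i, hi⟩ => ?_⟩
    have h1 := EntropyMetric.potential_anti (r := r) (hℓ.1 i) hi
    have h2 := EntropyMetric.potential_sub_le_entropyDist hr hone hℓ i
    linarith
  refine ⟨hone, fun D _ => hfar D, ?_⟩
  rintro ⟨B, hB⟩
  obtain ⟨ε, hε, h⟩ := hfar (B + 1)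
  obtain ⟨ℓ, hℓ, hi⟩ :=
    EntropyMetric.exists_mem_unitEntropy_apply_eq hr (⟨0, by omega⟩ : Fin r) hε
  have h1 := h ℓ hℓ ⟨_, hi.le⟩
  have h2 := hB ⟨_, hone, ℓ, hℓ, rfl⟩
  linarith
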